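/- All Hilbert spaces are complex; an operator is a bounded linear map of a Hilbert space into itself, and a contraction is an operator $T$ with $\|T\|\le 1$. An operator $T$ on $H$ is *weakly stable* if $\langle T^n x, z\rangle\to 0$ for all $x,z\in H$. It is *weakly l-sequentially supercyclic* if there is a nonzero $y\in H$ such that for every $x\in H$ there are nonzero scalars $\alpha_i\in\mathbb C$ and integers $0\le n_0<n_1<n_2<\cdots$ with $\alpha_i T^{n_i}y\to x$ weakly. A closed subspace $\mathcal M$ *reduces* $T$ if $\mathcal M$ and $\mathcal M^\perp$ are both $T$-invariant; $T$ is *completely nonunitary* if no restriction of $T$ to a nonzero closed reducing subspace is unitary. (1) Let $T$ be a contraction on a Hilbert space $H$ (of any dimension). (a) (Nagy–Foiaş–Langer decomposition.) There is exactly one closed subspace $\mathcal U\subseteq H$ that reduces $T$ and is such that $U=T|_{\mathcal U}$ is unitary and $C=T|_{\mathcal U^\perp}$ is a completely nonunitary contraction (either subspace may be $\{0\}$). The operator $U$ is called the unitary part of $T$. (b) If $T$ is completely nonunitary, then $T$ is weakly stable. (c) $T$ is not weakly stable if and only if $\mathcal U\neq\{0\}$ and $U$ is not weakly stable; and in this case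 $\|T\|=\|U\|=1$. (2) The following two assertions are equivalent: (i) every weakly l-sequentially supercyclic contraction on an infinite-dimensional Hilbert space is weakly stable; (ii) every weakly l-sequentially supercyclic unitary operator on an infinite-dimensional Hilbert space is weakly stable. -/

import Mathlib

open Filter Topology

namespace WeakDynamics

variable {H : Type*} [NormedAddCommGroup H] [InnerProductSpace ℂ H]

/-- Weak convergence `x n ⇀ a` of a sequence in an inner product space. -/
def WeaklyTendsto (x : ℕ → H) (a : H) : Prop :=
  ∀ z : H, Tendsto (fun n => inner ℂ z (x n)) atTop (𝓝 (inner ℂ z a))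

/-- `T` is weakly stable: `T ^ n x ⇀ 0` for every `x`. -/
def WeaklyStable (T : H →L[ℂ] H) : Prop :=
  ∀ x : H, WeaklyTendsto (fun n => (T ^ n) x) 0

/-- `y` is a weakly l-sequentially supercyclic vector for `T`: it is nonzero, and every `x` is the
weak limit of `α i • T ^ (n i) y` for some sequence `α` of nonzero scalars and some strictly
increasing sequence `n` of exponents. -/
def IsWeaklyLSeqSupercyclicVector (T : H →L[ℂ] H) (y : H) : Prop :=
  y ≠ 0 ∧ ∀ x : H, ∃ α : ℕ → ℂ, (∀ i, α i ≠ 0) ∧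
    ∃ n : ℕ → ℕ, StrictMono n ∧ WeaklyTendsto (fun i => α i • (T ^ n i) y) x

/-- `T` is weakly l-sequentially supercyclic. -/
def WeaklyLSeqSupercyclic (T : H →L[ℂ] H) : Prop :=
  ∃ y : H, IsWeaklyLSeqSupercyclicVector T y

/-- `U` is unitary: `U U* = U* U = I`. -/
def IsUnitary [CompleteSpace H] (U : H →L[ℂ] H) : Prop :=
  U ∈ unitary (H →L[ℂ] H)

/-- The subspace `M` reduces `T`: both `M` and its orthogonal complement are `T`-invariant. -/
structure Reduces (T : H →L[ℂ] H) (M : Submodule ℂ H) : Prop where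
  mapsTo : Set.MapsTo T M M
  mapsTo_orthogonal : Set.MapsTo T Mᗮ Mᗮ

/-- `T` is completely nonunitary: the restriction of `T` to a nonzero closed reducing subspace is
never unitary. (A subspace of a Hilbert space is complete iff it is closed.) -/
def CompletelyNonunitary (T : H →L[ℂ] H) : Prop :=
  ∀ (M : Submodule ℂ H) [CompleteSpace M] (hM : Reduces T M),
    IsUnitary (T.restrict hM.mapsTo) → M = ⊥

/-- `M` is a closed subspace that reduces `T`, the part of `T` on `M` is unitary and the part of
`T` on `Mᗮ` is a completely nonunitary contraction, so that `T = T|Mᗮ ⊕ T|M` is a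
Nagy–Foiaş–Langer decomposition of `T` and `T|M` is the unitary part of `T`. -/
structure IsUnitarySubspace (T : H →L[ℂ] H) (M : Submodule ℂ H) [CompleteSpace M] : Prop where
  reduces : Reduces T M
  isUnitary : IsUnitary (T.restrict reduces.mapsTo)
  norm_le_one : ‖T.restrict reduces.mapsTo_orthogonal‖ ≤ 1
  completelyNonunitary : CompletelyNonunitary (T.restrict reduces.mapsTo_orthogonal)

end WeakDynamics

open WeakDynamics

universe u

/-!
For a contraction `T`, the sequence `‖T† ^ n z‖` is nonincreasing, hence convergent, and therefore
`(1 - T T†) T† ^ n z → 0`. Pairing with `x` shows that `(1 - T T†) x` lies in the space `S` of the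
vectors with weakly null orbit. As moreover `T x ∈ S ↔ x ∈ S`, the space `S` is invariant under
`T†` and contains `(1 - T† T) x` too, so `T` is unitary on `Sᗮ` (Foguel). This proves that a
completely nonunitary contraction is weakly stable.

The conditions defining a unitary part are linear in the vector, so the reducing subspaces on which
`T` is unitary have a supremum with the same property, and this largest one is the only possible
unitary subspace.

For supercyclicity, project to the unitary part `M`, which inherits a supercyclic vector. If `M` is
nonzero and finite-dimensional and `α i • T ^ n i y` converges weakly to a vector of `Mᗮ`, then its
projection to `M`, where `T` is isometric, tends to `0` in norm; this forces `α i → 0`, so the limit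
vanishes. Hence `Mᗮ` is zero and the whole space is finite-dimensional.
-/

namespace WeakDynamics

open ContinuousLinearMap
open scoped InnerProduct

variable {H K : Type*} [NormedAddCommGroup H] [InnerProductSpace ℂ H]
  [NormedAddCommGroup K] [InnerProductSpace ℂ K]

/-! ### Weak convergence -/

theorem WeaklyTendsto.add {x y : ℕ → H} {a b : H} (hx : WeaklyTendsto x a)
    (hy : WeaklyTendsto y b) : WeaklyTendsto (fun n ↦ x n + y n) (a + b) := fun z ↦ by
  simpa only [inner_add_right] using (hx z).add (hy z)

theorem WeaklyTendsto.const_smul {x : ℕ → H} {a : H} (hx : WeaklyTendsto x a) (c : ℂ) :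
    WeaklyTendsto (fun n ↦ c • x n) (c • a) := fun z ↦ by
  simpa only [inner_smul_right] using (hx z).const_mul c

theorem WeaklyTendsto.unique {x : ℕ → H} {a b : H} (ha : WeaklyTendsto x a)
    (hb : WeaklyTendsto x b) : a = b :=
  ext_inner_left ℂ fun z ↦ tendsto_nhds_unique (ha z) (hb z)

theorem weaklyTendsto_of_tendsto {x : ℕ → H} {a : H} (hx : Tendsto x atTop (𝓝 a)) :
    WeaklyTendsto x a :=
  fun _ ↦ tendsto_const_nhds.inner hx

theorem WeaklyTendsto.tendsto [FiniteDimensional ℂ H] {x : ℕ → H} {a : H}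
    (hx : WeaklyTendsto x a) : Tendsto x atTop (𝓝 a) := by
  let b := stdOrthonormalBasis ℂ H
  have h : Tendsto (fun n ↦ ∑ i, inner ℂ (b i) (x n) • b i) atTop
      (𝓝 (∑ i, inner ℂ (b i) a • b i)) :=
    tendsto_finsetSum _ fun i _ ↦ (hx (b i)).smul_const (b i)
  simpa only [b.sum_repr'] using h

theorem WeaklyTendsto.map [CompleteSpace H] [CompleteSpace K] {x : ℕ → H} {a : H}
    (hx : WeaklyTendsto x a) (A : H →L[ℂ] K) : WeaklyTendsto (fun n ↦ A (x n)) (A a) :=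
  fun z ↦ by simpa only [adjoint_inner_left] using hx ((A†) z)

theorem weaklyTendsto_coe_iff [CompleteSpace H] {M : Submodule ℂ H} [CompleteSpace M]
    {x : ℕ → M} {a : M} : WeaklyTendsto (fun n ↦ (x n : H)) a ↔ WeaklyTendsto x a :=
  ⟨fun h ↦ by simpa only [Submodule.orthogonalProjectionOnto_mem_subspace_eq_self] using
    WeaklyTendsto.map h M.orthogonalProjectionOnto, fun h ↦ h.map M.subtypeL⟩

/-! ### Powers and restrictions -/

theorem norm_pow_le_one {T : H →L[ℂ] H} (hT : ‖T‖ ≤ 1) (n : ℕ) : ‖T ^ n‖ ≤ 1 := by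
  induction n with
  | zero => exact norm_id_le
  | succ n ih =>
    rw [pow_succ]
    exact (norm_mul_le _ _).trans (mul_le_one₀ ih (norm_nonneg _) hT)

theorem norm_restrict_le (T : H →L[ℂ] H) {M : Submodule ℂ H} (hM : Set.MapsTo T M M) :
    ‖T.restrict hM‖ ≤ ‖T‖ :=
  opNorm_le_bound _ (norm_nonneg _) fun x ↦ T.le_opNorm x

theorem apply_pow_apply_of_semiconj {T : H →L[ℂ] H} {S : K →L[ℂ] K} {A : H →L[ℂ] K}
    (h : Function.Semiconj A T S) (n : ℕ) (x : H) : A ((T ^ n) x) = (S ^ n) (A x) := by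
  simpa only [FunLike.coe_pow_eq_iterate] using h.iterate_right n x

theorem coe_restrict_pow_apply (T : H →L[ℂ] H) {M : Submodule ℂ H} (hM : Set.MapsTo T M M)
    (n : ℕ) (x : M) : (((T.restrict hM) ^ n) x : H) = (T ^ n) x :=
  apply_pow_apply_of_semiconj (A := M.subtypeL) (fun _ ↦ rfl) n x

/-! ### Vectors with weakly null orbit -/

/-- The subspace of all vectors `x` with `T ^ n x ⇀ 0`. -/
def weaklyStableSubspace (T : H →L[ℂ] H) : Submodule ℂ H where
  carrier := {x | WeaklyTendsto (fun n ↦ (T ^ n) x) 0}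
  add_mem' hx hy := by simpa only [Set.mem_ofPred_eq, map_add, add_zero] using hx.add hy
  zero_mem' := by
    simpa only [Set.mem_ofPred_eq, map_zero] using weaklyTendsto_of_tendsto tendsto_const_nhds
  smul_mem' c x hx := by
    simpa only [Set.mem_ofPred_eq, map_smul, smul_zero] using hx.const_smul c

theorem weaklyStable_iff_weaklyStableSubspace_eq_top {T : H →L[ℂ] H} :
    WeaklyStable T ↔ weaklyStableSubspace T = ⊤ :=
  (Submodule.eq_top_iff' (p := weaklyStableSubspace T)).symm

theorem mem_weaklyStableSubspace_iff_inner {T : H →L[ℂ] H} {x : H} :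
    x ∈ weaklyStableSubspace T ↔ ∀ z, Tendsto (fun n ↦ inner ℂ z ((T ^ n) x)) atTop (𝓝 0) :=
  forall_congr' fun z ↦ by rw [inner_zero_right]

theorem apply_mem_weaklyStableSubspace_iff {T : H →L[ℂ] H} {x : H} :
    T x ∈ weaklyStableSubspace T ↔ x ∈ weaklyStableSubspace T := by
  simp only [mem_weaklyStableSubspace_iff_inner]
  exact forall_congr' fun z ↦ tendsto_add_atTop_iff_nat (f := fun n ↦ inner ℂ z ((T ^ n) x)) 1

theorem isClosed_weaklyStableSubspace {T : H →L[ℂ] H} {C : ℝ} (hC : ∀ n, ‖T ^ n‖ ≤ C) :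
    IsClosed (weaklyStableSubspace T : Set H) := by
  have hclosed (z : H) :
      IsClosed {x | Tendsto (fun n ↦ inner ℂ z ((T ^ n) x)) atTop (𝓝 0)} := by
    have hlip (n : ℕ) : LipschitzWith (‖z‖ * C).toNNReal fun x ↦ inner ℂ z ((T ^ n) x) :=
      lipschitzWith_of_opNorm_le (f := innerSL ℂ z ∘L T ^ n) <|
        calc ‖innerSL ℂ z ∘L T ^ n‖ ≤ ‖innerSL ℂ z‖ * ‖T ^ n‖ := opNorm_comp_le _ _
          _ ≤ ‖z‖ * C := by rw [innerSL_apply_norm]; gcongr; exact hC n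
          _ ≤ (‖z‖ * C).toNNReal := Real.le_coe_toNNReal _
    exact (LipschitzWith.uniformEquicontinuous _ _ hlip).equicontinuous.isClosed_setOfPred_tendsto
      continuous_const
  convert isClosed_iInter hclosed
  ext x
  simp only [SetLike.mem_coe, mem_weaklyStableSubspace_iff_inner, Set.mem_iInter, Set.mem_ofPred_eq]

section Complete

variable [CompleteSpace H] {T : H →L[ℂ] H} {M : Submodule ℂ H}

theorem adjoint_pow_apply_inner_left (T : H →L[ℂ] H) (n : ℕ) (z x : H) :
    inner ℂ (((T†) ^ n) z) x = inner ℂ z ((T ^ n) x) := by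
  rw [← star_eq_adjoint, ← star_pow, star_eq_adjoint, adjoint_inner_left]

theorem weaklyStableSubspace_restrict [CompleteSpace M] (hM : Set.MapsTo T M M) :
    weaklyStableSubspace (T.restrict hM) = (weaklyStableSubspace T).comap M.subtype := by
  ext x
  change WeaklyTendsto _ _ ↔ WeaklyTendsto _ _
  rw [← weaklyTendsto_coe_iff]
  simp only [coe_restrict_pow_apply, Submodule.subtype_apply, Submodule.coe_zero]

theorem weaklyStable_restrict_iff [CompleteSpace M] (hM : Set.MapsTo T M M) :
    WeaklyStable (T.restrict hM) ↔ M ≤ weaklyStableSubspace T := by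
  rw [weaklyStable_iff_weaklyStableSubspace_eq_top, weaklyStableSubspace_restrict,
    Submodule.comap_subtype_eq_top]

theorem weaklyStable_iff_of_reduces [CompleteSpace M] (hM : Reduces T M) :
    WeaklyStable T ↔ WeaklyStable (T.restrict hM.mapsTo) ∧
      WeaklyStable (T.restrict hM.mapsTo_orthogonal) := by
  rw [weaklyStable_restrict_iff, weaklyStable_restrict_iff, ← sup_le_iff,
    Submodule.sup_orthogonal_of_hasOrthogonalProjection, top_le_iff,
    weaklyStable_iff_weaklyStableSubspace_eq_top]

/-! ### Reducing subspaces -/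

theorem mapsTo_orthogonal_of_mapsTo_adjoint (h : Set.MapsTo (T†) M M) : Set.MapsTo T Mᗮ Mᗮ :=
  orthogonal_mem_invtSubmodule h

theorem mapsTo_adjoint_orthogonal_of_mapsTo (h : Set.MapsTo T M M) : Set.MapsTo (T†) Mᗮ Mᗮ :=
  mapsTo_orthogonal_of_mapsTo_adjoint (by rwa [adjoint_adjoint])

omit [CompleteSpace H] in
theorem Reduces.orthogonal [CompleteSpace M] (hM : Reduces T M) : Reduces T Mᗮ :=
  ⟨hM.mapsTo_orthogonal, by rw [Submodule.orthogonal_orthogonal]; exact hM.mapsTo⟩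

theorem Reduces.mapsTo_adjoint [CompleteSpace M] (hM : Reduces T M) : Set.MapsTo (T†) M M := by
  simpa only [Submodule.orthogonal_orthogonal] using
    mapsTo_adjoint_orthogonal_of_mapsTo hM.mapsTo_orthogonal

theorem Reduces.coe_adjoint_restrict_apply [CompleteSpace M] (hM : Reduces T M) (x : M) :
    (((T.restrict hM.mapsTo)†) x : H) = (T†) x := by
  have h : (T†).restrict hM.mapsTo_adjoint = (T.restrict hM.mapsTo)† :=
    (eq_adjoint_iff _ _).2 fun x y ↦ adjoint_inner_left T (y : H) (x : H)
  rw [← h]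
  rfl

omit [CompleteSpace H] in
theorem Reduces.orthogonalProjectionOnto_apply [CompleteSpace M] (hM : Reduces T M) (x : H) :
    M.orthogonalProjectionOnto (T x) = T.restrict hM.mapsTo (M.orthogonalProjectionOnto x) := by
  obtain ⟨p, hp, q, hq, rfl⟩ := M.exists_add_mem_mem_orthogonal x
  lift p to M using hp
  have hTp : T p = T.restrict hM.mapsTo p := rfl
  simp only [map_add, Submodule.orthogonalProjectionOnto_apply_of_mem_orthogonal hq,
    Submodule.orthogonalProjectionOnto_apply_of_mem_orthogonal (hM.mapsTo_orthogonal hq), hTp,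
    Submodule.orthogonalProjectionOnto_mem_subspace_eq_self, map_zero]

/-! ### The largest subspace on which an operator is unitary -/

/-- `T` and its adjoint leave `M` invariant and act on it as mutually inverse maps. For closed `M`
this says that `M` reduces `T` to a unitary operator, see `Reduces.isUnitary_restrict_iff`;
closedness is not required, so that the notion passes to suprema. -/
structure IsUnitaryOn (T : H →L[ℂ] H) (M : Submodule ℂ H) : Prop where
  mapsTo : Set.MapsTo T M M
  mapsTo_adjoint : Set.MapsTo (T†) M M
  adjoint_apply_apply : ∀ x ∈ M, (T†) (T x) = x
  apply_adjoint_apply : ∀ x ∈ M, T ((T†) x) = x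

theorem IsUnitaryOn.reduces (hM : IsUnitaryOn T M) : Reduces T M :=
  ⟨hM.mapsTo, mapsTo_orthogonal_of_mapsTo_adjoint hM.mapsTo_adjoint⟩

theorem Reduces.isUnitary_restrict_iff [CompleteSpace M] (hM : Reduces T M) :
    IsUnitary (T.restrict hM.mapsTo) ↔ IsUnitaryOn T M := by
  have hcoe (x : M) : (T.restrict hM.mapsTo x : H) = T x := rfl
  simp only [IsUnitary, Unitary.mem_iff, star_eq_adjoint, ContinuousLinearMap.ext_iff,
    Subtype.ext_iff, mul_apply_eq_comp, one_apply_eq_self, hcoe, hM.coe_adjoint_restrict_apply,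
    Subtype.forall]
  exact ⟨fun h ↦ ⟨hM.mapsTo, hM.mapsTo_adjoint, h.1, h.2⟩,
    fun h ↦ ⟨h.adjoint_apply_apply, h.apply_adjoint_apply⟩⟩

theorem IsUnitaryOn.topologicalClosure (hM : IsUnitaryOn T M) :
    IsUnitaryOn T M.topologicalClosure where
  mapsTo := hM.mapsTo.closure T.continuous
  mapsTo_adjoint := hM.mapsTo_adjoint.closure (T†).continuous
  adjoint_apply_apply :=
    closure_minimal hM.adjoint_apply_apply (isClosed_eq (by fun_prop) continuous_id)
  apply_adjoint_apply :=
    closure_minimal hM.apply_adjoint_apply (isClosed_eq (by fun_prop) continuous_id)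

theorem isUnitaryOn_sSup {s : Set (Submodule ℂ H)} (hs : ∀ M ∈ s, IsUnitaryOn T M) :
    IsUnitaryOn T (sSup s) where
  mapsTo := show sSup s ≤ (sSup s).comap T.toLinearMap from
    sSup_le fun M hM _ hx ↦ le_sSup hM ((hs M hM).mapsTo hx)
  mapsTo_adjoint := show sSup s ≤ (sSup s).comap (T†).toLinearMap from
    sSup_le fun M hM _ hx ↦ le_sSup hM ((hs M hM).mapsTo_adjoint hx)
  adjoint_apply_apply := show sSup s ≤ (T† ∘L T).toLinearMap.eqLocus LinearMap.id from
    sSup_le fun M hM ↦ (hs M hM).adjoint_apply_apply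
  apply_adjoint_apply := show sSup s ≤ (T ∘L T†).toLinearMap.eqLocus LinearMap.id from
    sSup_le fun M hM ↦ (hs M hM).apply_adjoint_apply

/-- The largest subspace on which `T` is unitary. -/
def unitarySubspace (T : H →L[ℂ] H) : Submodule ℂ H :=
  sSup {M | IsUnitaryOn T M}

theorem isUnitaryOn_unitarySubspace (T : H →L[ℂ] H) : IsUnitaryOn T (unitarySubspace T) :=
  isUnitaryOn_sSup fun _ ↦ id

theorem IsUnitaryOn.le_unitarySubspace (hM : IsUnitaryOn T M) : M ≤ unitarySubspace T :=
  le_sSup hM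

instance completeSpace_unitarySubspace (T : H →L[ℂ] H) : CompleteSpace (unitarySubspace T) := by
  have hle : (unitarySubspace T).topologicalClosure ≤ unitarySubspace T :=
    (isUnitaryOn_unitarySubspace T).topologicalClosure.le_unitarySubspace
  exact (isClosed_of_closure_subset hle).completeSpace_coe

theorem Reduces.unitarySubspace_restrict [CompleteSpace M] (hM : Reduces T M) :
    unitarySubspace (T.restrict hM.mapsTo) = (unitarySubspace T).comap M.subtype := by
  have hU := isUnitaryOn_unitarySubspace T
  have hV := isUnitaryOn_unitarySubspace (T.restrict hM.mapsTo)
  have hadj := hM.coe_adjoint_restrict_apply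
  refine le_antisymm (Submodule.map_le_iff_le_comap.1 (IsUnitaryOn.le_unitarySubspace ?_))
    (IsUnitaryOn.le_unitarySubspace ?_)
  · constructor
    · rintro _ ⟨x, hx, rfl⟩
      exact ⟨_, hV.mapsTo hx, rfl⟩
    · rintro _ ⟨x, hx, rfl⟩
      exact ⟨_, hV.mapsTo_adjoint hx, hadj x⟩
    · rintro _ ⟨x, hx, rfl⟩
      exact (hadj _).symm.trans (congrArg Subtype.val (hV.adjoint_apply_apply x hx))
    · rintro _ ⟨x, hx, rfl⟩
      exact (congrArg T (hadj x)).symm.trans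
        (congrArg Subtype.val (hV.apply_adjoint_apply x hx))
  · constructor
    · exact fun x hx ↦ hU.mapsTo hx
    · intro x hx
      simpa only [SetLike.mem_coe, Submodule.mem_comap, Submodule.subtype_apply, hadj]
        using hU.mapsTo_adjoint hx
    · exact fun x hx ↦ Subtype.ext ((hadj _).trans (hU.adjoint_apply_apply x hx))
    · exact fun x hx ↦ Subtype.ext ((congrArg T (hadj x)).trans (hU.apply_adjoint_apply x hx))

theorem completelyNonunitary_iff : CompletelyNonunitary T ↔ unitarySubspace T = ⊥ := by
  constructor
  · intro hT
    have hU := isUnitaryOn_unitarySubspace T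
    exact hT _ hU.reduces (hU.reduces.isUnitary_restrict_iff.2 hU)
  · intro hT M _ hM hu
    exact le_bot_iff.1 (hT ▸ (hM.isUnitary_restrict_iff.1 hu).le_unitarySubspace)

theorem Reduces.completelyNonunitary_restrict_iff [CompleteSpace M] (hM : Reduces T M) :
    CompletelyNonunitary (T.restrict hM.mapsTo) ↔ Disjoint M (unitarySubspace T) := by
  rw [completelyNonunitary_iff, hM.unitarySubspace_restrict, Submodule.disjoint_iff_comap_eq_bot]

/-! ### The Nagy–Foiaş–Langer decomposition -/

theorem isUnitarySubspace_unitarySubspace (hT : ‖T‖ ≤ 1) :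
    IsUnitarySubspace T (unitarySubspace T) :=
  have hU := isUnitaryOn_unitarySubspace T
  { reduces := hU.reduces
    isUnitary := hU.reduces.isUnitary_restrict_iff.2 hU
    norm_le_one := (norm_restrict_le T _).trans hT
    completelyNonunitary := hU.reduces.orthogonal.completelyNonunitary_restrict_iff.2
      (Submodule.orthogonal_disjoint _).symm }

theorem IsUnitarySubspace.isUnitaryOn [CompleteSpace M] (hM : IsUnitarySubspace T M) :
    IsUnitaryOn T M :=
  hM.reduces.isUnitary_restrict_iff.1 hM.isUnitary

theorem IsUnitarySubspace.eq_unitarySubspace [CompleteSpace M] (hM : IsUnitarySubspace T M) :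
    M = unitarySubspace T := by
  have hdisj : Mᗮ ⊓ unitarySubspace T = ⊥ :=
    (hM.reduces.orthogonal.completelyNonunitary_restrict_iff.1 hM.completelyNonunitary).eq_bot
  rw [← Submodule.sup_orthogonal_inf_of_hasOrthogonalProjection hM.isUnitaryOn.le_unitarySubspace,
    hdisj, sup_bot_eq]

theorem existsUnique_isUnitarySubspace (hT : ‖T‖ ≤ 1) :
    ∃! M : Submodule ℂ H, ∃ _ : CompleteSpace M, IsUnitarySubspace T M :=
  ⟨unitarySubspace T, ⟨inferInstance, isUnitarySubspace_unitarySubspace hT⟩,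
    fun _ ⟨_, hM⟩ ↦ hM.eq_unitarySubspace⟩

theorem IsUnitary.norm_le_one {U : H →L[ℂ] H} (hU : IsUnitary U) : ‖U‖ ≤ 1 :=
  opNorm_le_bound _ zero_le_one fun x ↦ by rw [norm_map_of_mem_unitary hU, one_mul]

omit [CompleteSpace H] in
theorem IsUnitarySubspace.norm_restrict_eq_one [CompleteSpace M] (hM : IsUnitarySubspace T M)
    (hne : M ≠ ⊥) : ‖T.restrict hM.reduces.mapsTo‖ = 1 :=
  have : Nontrivial M := Submodule.nontrivial_iff_ne_bot.2 hne
  CStarRing.norm_of_mem_unitary hM.isUnitary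

/-! ### Weak stability of completely nonunitary contractions -/

theorem norm_sub_adjoint_apply_apply_sq_le (hT : ‖T‖ ≤ 1) (x : H) :
    ‖x - (T†) (T x)‖ ^ 2 ≤ ‖x‖ ^ 2 - ‖T x‖ ^ 2 := by
  have hle : ‖(T†) (T x)‖ ≤ ‖T x‖ := by
    simpa only [one_mul] using (T†).le_of_opNorm_le ((adjoint.norm_map T).trans_le hT) (T x)
  have hinner : RCLike.re (inner ℂ x ((T†) (T x))) = ‖T x‖ ^ 2 := by
    rw [adjoint_inner_right, inner_self_eq_norm_sq]
  calc ‖x - (T†) (T x)‖ ^ 2 = ‖x‖ ^ 2 - 2 * ‖T x‖ ^ 2 + ‖(T†) (T x)‖ ^ 2 := by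
        rw [norm_sub_sq (𝕜 := ℂ), hinner]
    _ ≤ ‖x‖ ^ 2 - 2 * ‖T x‖ ^ 2 + ‖T x‖ ^ 2 := by gcongr
    _ = ‖x‖ ^ 2 - ‖T x‖ ^ 2 := by ring

theorem tendsto_pow_apply_sub_adjoint_apply_apply (hT : ‖T‖ ≤ 1) (x : H) :
    Tendsto (fun n ↦ (T ^ n) x - (T†) (T ((T ^ n) x))) atTop (𝓝 0) := by
  have hsucc (n : ℕ) : T ((T ^ n) x) = (T ^ (n + 1)) x := by rw [pow_succ', mul_apply_eq_comp]
  have hanti : Antitone fun n ↦ ‖(T ^ n) x‖ ^ 2 := antitone_nat_of_succ_le fun n ↦ by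
    rw [← hsucc]
    gcongr
    simpa only [one_mul] using T.le_of_opNorm_le hT ((T ^ n) x)
  have hlim := tendsto_atTop_ciInf hanti ⟨0, by rintro _ ⟨n, rfl⟩; positivity⟩
  have hdiff : Tendsto (fun n ↦ ‖(T ^ n) x‖ ^ 2 - ‖T ((T ^ n) x)‖ ^ 2) atTop (𝓝 0) := by
    simpa only [hsucc, sub_self] using hlim.sub ((tendsto_add_atTop_iff_nat 1).2 hlim)
  have hsq := squeeze_zero (fun _ ↦ sq_nonneg _)
    (fun n ↦ norm_sub_adjoint_apply_apply_sq_le hT ((T ^ n) x)) hdiff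
  rw [tendsto_zero_iff_norm_tendsto_zero]
  simpa only [Real.sqrt_sq (norm_nonneg _), Real.sqrt_zero] using hsq.sqrt

theorem sub_apply_adjoint_mem_weaklyStableSubspace (hT : ‖T‖ ≤ 1) (x : H) :
    x - T ((T†) x) ∈ weaklyStableSubspace T := by
  refine mem_weaklyStableSubspace_iff_inner.2 fun z ↦ ?_
  have hlim := tendsto_pow_apply_sub_adjoint_apply_apply ((adjoint.norm_map T).trans_le hT) z
  have hinner (n : ℕ) : inner ℂ z ((T ^ n) (x - T ((T†) x))) =
      inner ℂ (((T†) ^ n) z - (T††) ((T†) (((T†) ^ n) z))) x := by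
    rw [← adjoint_pow_apply_inner_left, inner_sub_left, inner_sub_right, adjoint_inner_left (T†),
      adjoint_inner_left]
  simpa only [hinner, inner_zero_left] using hlim.inner (tendsto_const_nhds (x := x))

theorem sub_adjoint_apply_mem_weaklyStableSubspace (hT : ‖T‖ ≤ 1) (x : H) :
    x - (T†) (T x) ∈ weaklyStableSubspace T := by
  rw [← apply_mem_weaklyStableSubspace_iff, map_sub]
  exact sub_apply_adjoint_mem_weaklyStableSubspace hT (T x)

theorem mapsTo_adjoint_weaklyStableSubspace (hT : ‖T‖ ≤ 1) :
    Set.MapsTo (T†) (weaklyStableSubspace T) (weaklyStableSubspace T) := fun x hx ↦ by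
  have h := sub_mem hx (sub_apply_adjoint_mem_weaklyStableSubspace hT x)
  rw [sub_sub_cancel] at h
  exact apply_mem_weaklyStableSubspace_iff.1 h

theorem isUnitaryOn_orthogonal_weaklyStableSubspace (hT : ‖T‖ ≤ 1) :
    IsUnitaryOn T (weaklyStableSubspace T)ᗮ := by
  have hmap : Set.MapsTo T (weaklyStableSubspace T)ᗮ (weaklyStableSubspace T)ᗮ :=
    mapsTo_orthogonal_of_mapsTo_adjoint (mapsTo_adjoint_weaklyStableSubspace hT)
  have hadj : Set.MapsTo (T†) (weaklyStableSubspace T)ᗮ (weaklyStableSubspace T)ᗮ :=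
    mapsTo_adjoint_orthogonal_of_mapsTo fun _ ↦ apply_mem_weaklyStableSubspace_iff.2
  have hzero {x : H} (hx : x ∈ weaklyStableSubspace T) (hx' : x ∈ (weaklyStableSubspace T)ᗮ) :
      x = 0 := Submodule.disjoint_def.1 (Submodule.orthogonal_disjoint _) x hx hx'
  refine ⟨hmap, hadj, fun x hx ↦ ?_, fun x hx ↦ ?_⟩
  · exact (sub_eq_zero.1 (hzero (sub_adjoint_apply_mem_weaklyStableSubspace hT x)
      (sub_mem hx (hadj (hmap hx))))).symm
  · exact (sub_eq_zero.1 (hzero (sub_apply_adjoint_mem_weaklyStableSubspace hT x)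
      (sub_mem hx (hmap (hadj hx))))).symm

theorem CompletelyNonunitary.weaklyStable (hT : ‖T‖ ≤ 1) (hc : CompletelyNonunitary T) :
    WeaklyStable T := by
  have : CompleteSpace (weaklyStableSubspace T) :=
    (isClosed_weaklyStableSubspace (norm_pow_le_one hT)).completeSpace_coe
  have hbot : (weaklyStableSubspace T)ᗮ = ⊥ := le_bot_iff.1 <|
    completelyNonunitary_iff.1 hc ▸
      (isUnitaryOn_orthogonal_weaklyStableSubspace hT).le_unitarySubspace
  exact weaklyStable_iff_weaklyStableSubspace_eq_top.2 (Submodule.orthogonal_eq_bot_iff.1 hbot)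

theorem IsUnitarySubspace.weaklyStable_iff [CompleteSpace M] (hM : IsUnitarySubspace T M) :
    WeaklyStable T ↔ WeaklyStable (T.restrict hM.reduces.mapsTo) := by
  rw [weaklyStable_iff_of_reduces hM.reduces]
  exact and_iff_left (hM.completelyNonunitary.weaklyStable hM.norm_le_one)

theorem IsUnitarySubspace.ne_bot_of_not_weaklyStable [CompleteSpace M]
    (hM : IsUnitarySubspace T M) (hT : ¬ WeaklyStable T) : M ≠ ⊥ := by
  rintro rfl
  exact hT (hM.weaklyStable_iff.2 ((weaklyStable_restrict_iff _).2 bot_le))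

/-! ### Supercyclicity and the unitary part -/

theorem IsWeaklyLSeqSupercyclicVector.map_of_surjective [CompleteSpace K] [Nontrivial K]
    {S : K →L[ℂ] K} {y : H} (hy : IsWeaklyLSeqSupercyclicVector T y) {A : H →L[ℂ] K}
    (hA : Function.Surjective A) (hTS : Function.Semiconj A T S) :
    IsWeaklyLSeqSupercyclicVector S (A y) := by
  have happrox (v : K) : ∃ α : ℕ → ℂ, (∀ i, α i ≠ 0) ∧ ∃ n : ℕ → ℕ, StrictMono n ∧
      WeaklyTendsto (fun i ↦ α i • (S ^ n i) (A y)) v := by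
    obtain ⟨x, rfl⟩ := hA v
    obtain ⟨α, hα, n, hn, hlim⟩ := hy.2 x
    exact ⟨α, hα, n, hn, by
      simpa only [map_smul, apply_pow_apply_of_semiconj hTS] using hlim.map A⟩
  refine ⟨fun hzero ↦ ?_, happrox⟩
  obtain ⟨v, hv⟩ := exists_ne (0 : K)
  obtain ⟨α, -, n, -, hlim⟩ := happrox v
  simp only [hzero, map_zero, smul_zero] at hlim
  exact hv (hlim.unique (weaklyTendsto_of_tendsto tendsto_const_nhds))

theorem IsWeaklyLSeqSupercyclicVector.orthogonalProjectionOnto [CompleteSpace M] {y : H}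
    (hy : IsWeaklyLSeqSupercyclicVector T y) (hM : Reduces T M) (hne : M ≠ ⊥) :
    IsWeaklyLSeqSupercyclicVector (T.restrict hM.mapsTo) (M.orthogonalProjectionOnto y) :=
  have : Nontrivial M := Submodule.nontrivial_iff_ne_bot.2 hne
  hy.map_of_surjective
    (fun x ↦ ⟨x, Submodule.orthogonalProjectionOnto_mem_subspace_eq_self x⟩)
    hM.orthogonalProjectionOnto_apply

theorem IsWeaklyLSeqSupercyclicVector.injective_of_norm_preserving [FiniteDimensional ℂ K]
    {C : ℝ} (hC : ∀ n, ‖T ^ n‖ ≤ C) {S : K →L[ℂ] K} (hS : ∀ v, ‖S v‖ = ‖v‖) {y : H}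
    (hy : IsWeaklyLSeqSupercyclicVector T y) {A : H →L[ℂ] K} (hTS : Function.Semiconj A T S)
    (hAy : A y ≠ 0) : Function.Injective A := by
  have : CompleteSpace K := FiniteDimensional.complete ℂ K
  have hSpow (n : ℕ) (v : K) : ‖(S ^ n) v‖ = ‖v‖ := by
    have h : Function.Semiconj norm S id := hS
    simpa only [FunLike.coe_pow_eq_iterate, Function.iterate_id, id] using h.iterate_right n v
  refine (injective_iff_map_eq_zero A).2 fun x hx ↦ ?_
  obtain ⟨α, -, n, -, hlim⟩ := hy.2 x
  have hAlim : Tendsto (fun i ↦ α i • (S ^ n i) (A y)) atTop (𝓝 0) := by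
    simpa only [map_smul, apply_pow_apply_of_semiconj hTS, hx] using (hlim.map A).tendsto
  have hα : Tendsto α atTop (𝓝 0) := by
    have h := hAlim.norm.mul_const ‖A y‖⁻¹
    simp only [norm_smul, hSpow, norm_zero, zero_mul,
      mul_inv_cancel_right₀ (norm_ne_zero_iff.2 hAy)] at h
    exact tendsto_zero_iff_norm_tendsto_zero.2 h
  have hbdd : IsBoundedUnder (· ≤ ·) atTop fun i ↦ ‖(T ^ n i) y‖ :=
    isBoundedUnder_of ⟨C * ‖y‖, fun i ↦ (T ^ n i).le_of_opNorm_le (hC (n i)) y⟩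
  exact hlim.unique (weaklyTendsto_of_tendsto (hα.zero_smul_isBoundedUnder_le hbdd))

theorem WeaklyLSeqSupercyclic.restrict [CompleteSpace M] (hT : WeaklyLSeqSupercyclic T)
    (hM : Reduces T M) (hne : M ≠ ⊥) : WeaklyLSeqSupercyclic (T.restrict hM.mapsTo) :=
  let ⟨_, hy⟩ := hT
  ⟨_, hy.orthogonalProjectionOnto hM hne⟩

theorem WeaklyLSeqSupercyclic.finiteDimensional_of_isUnitary_restrict [FiniteDimensional ℂ M]
    {C : ℝ} (hC : ∀ n, ‖T ^ n‖ ≤ C) (hT : WeaklyLSeqSupercyclic T) (hM : Reduces T M)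
    (hu : IsUnitary (T.restrict hM.mapsTo)) (hne : M ≠ ⊥) : FiniteDimensional ℂ H := by
  obtain ⟨y, hy⟩ := hT
  exact .of_injective M.orthogonalProjectionOnto.toLinearMap <|
    hy.injective_of_norm_preserving hC (norm_map_of_mem_unitary hu)
      hM.orthogonalProjectionOnto_apply (hy.orthogonalProjectionOnto hM hne).1

end Complete

end WeakDynamics

theorem mainTheorem3 :
    (∀ (H : Type u) [NormedAddCommGroup H] [InnerProductSpace ℂ H] [CompleteSpace H]
        (T : H →L[ℂ] H), ‖T‖ ≤ 1 →
      -- existence and uniqueness of the Nagy–Foiaş–Langer decomposition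
      (∃! M : Submodule ℂ H, ∃ _ : CompleteSpace M, IsUnitarySubspace T M) ∧
      -- completely nonunitary contractions are weakly stable
      (CompletelyNonunitary T → WeaklyStable T) ∧
      -- weak instability is carried by the unitary part
      (∀ (M : Submodule ℂ H) [CompleteSpace M] (hM : IsUnitarySubspace T M),
        (¬ WeaklyStable T ↔
          M ≠ ⊥ ∧ ¬ WeaklyStable (T.restrict hM.reduces.mapsTo)) ∧
        (¬ WeaklyStable T → ‖T‖ = 1 ∧ ‖T.restrict hM.reduces.mapsTo‖ = 1))) ∧
    -- the question for contractions is equivalent to the question for unitary operators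
    ((∀ (H : Type u) [NormedAddCommGroup H] [InnerProductSpace ℂ H] [CompleteSpace H],
        ¬ FiniteDimensional ℂ H →
        ∀ T : H →L[ℂ] H, ‖T‖ ≤ 1 → WeaklyLSeqSupercyclic T → WeaklyStable T) ↔
      (∀ (H : Type u) [NormedAddCommGroup H] [InnerProductSpace ℂ H] [CompleteSpace H],
        ¬ FiniteDimensional ℂ H →
        ∀ U : H →L[ℂ] H, IsUnitary U → WeaklyLSeqSupercyclic U → WeaklyStable U)) := by
  refine ⟨fun H _ _ _ T hT ↦ ⟨existsUnique_isUnitarySubspace hT,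
    fun hc ↦ hc.weaklyStable hT, fun M _ hM ↦ ⟨?_, fun hns ↦ ?_⟩⟩,
    fun h H _ _ _ hH U hU ↦ h H hH U hU.norm_le_one, fun h H _ _ _ hH T hT hsc ↦ ?_⟩
  · rw [← hM.weaklyStable_iff]
    exact ⟨fun hns ↦ ⟨hM.ne_bot_of_not_weaklyStable hns, hns⟩, And.right⟩
  · have hU := hM.norm_restrict_eq_one (hM.ne_bot_of_not_weaklyStable hns)
    exact ⟨le_antisymm hT (hU ▸ norm_restrict_le T hM.reduces.mapsTo), hU⟩
  · by_contra hns
    have hM := isUnitarySubspace_unitarySubspace hT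
    have hne := hM.ne_bot_of_not_weaklyStable hns
    have hinf : ¬ FiniteDimensional ℂ (unitarySubspace T) := fun _ ↦
      hH (hsc.finiteDimensional_of_isUnitary_restrict (norm_pow_le_one hT) hM.reduces
        hM.isUnitary hne)
    have hstable : WeaklyStable (T.restrict hM.reduces.mapsTo) :=
      h _ hinf _ hM.isUnitary (hsc.restrict hM.reduces hne)
    exact hns (hM.weaklyStable_iff.2 hstable)
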